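/- Let $N\ge 3$ and let $\omega_{N-1}$ denote the surface measure of the unit sphere in $\mathbb R^N$. Let $\mathcal D^{1,2}(\mathbb R^N)$ be the closure of $C_c^\infty(\mathbb R^N)$ with respect to the norm $\left(\int_{\mathbb R^N}|\nabla u|^2\,dx\right)^{1/2}$, realised as a space of functions through the Sobolev embedding into $L^{2N/(N-2)}(\mathbb R^N)$, and let $$\mathcal X:=\{u\in\mathcal D^{1,2}(\mathbb R^N)\,:\, u \text{ is Lipschitz continuous and } \|\nabla u\|_{L^\infty(\mathbb R^N)}\le 1\}.$$ Then $$\bar C:=\inf_{u\in\mathcal X\setminus\{0\}}\frac{\|\nabla u\|^2_{L^2(\mathbb R^N)}}{\|u\|^N_{L^\infty(\mathbb R^N)}}=\frac{2}{N}\left(\frac{N-2}{N-1}\right)^{N-1}\omega_{N-1};$$ equivalently, this number is the largest constant $C$ such that $\|\nabla u\|^2_{L^2(\mathbb R^N)}\ge C\|u\|^N_{L^\infty(\mathbb R^N)}$ for all $u\in\mathcal X$. With $\bar R:=\frac{N-2}{N-1}$, the infimum is attained by the radial function $$\bar u(x)=\begin{cases}1-|x| & \text{if } |x|\le\bar R,\\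 \bar R^{\,N-2}(1-\bar R)\,|x|^{2-N} & \text{if } |x|>\bar R,\end{cases}$$ which belongs to $\mathcal X\setminus\{0\}$ and is harmonic in $\{|x|>\bar R\}$. -/

import Mathlib

open MeasureTheory Filter Topology
open scoped ENNReal ContDiff

noncomputable section

/-- The Euclidean space `ℝ^N`. -/
abbrev RN (N : ℕ) : Type := EuclideanSpace ℝ (Fin N)

/-- The critical Sobolev exponent `2* = 2N/(N-2)` (used for `N ≥ 3`). -/
def sobolevExponent (N : ℕ) : ℝ≥0∞ := ENNReal.ofReal (2 * (N : ℝ) / ((N : ℝ) - 2))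

/-- `u` belongs to `D^{1,2}(ℝ^N)` (`N ≥ 3`) and `G` is its (weak) gradient: there are functions
`φ n ∈ C_c^∞(ℝ^N)` with `∇ φ n → G` in `L²`. The completion of `C_c^∞` for the norm `‖∇ ·‖_{L²}` is
realised as a space of functions in the usual way, the limit `u` being the one in `L^{2*}` given by
the Sobolev inequality. -/
def HasD12Gradient {N : ℕ} (u : RN N → ℝ) (G : RN N → RN N) : Prop :=
  AEStronglyMeasurable u volume ∧ AEStronglyMeasurable G volume ∧
    ∃ φ : ℕ → RN N → ℝ,
      (∀ n, ContDiff ℝ ∞ (φ n) ∧ HasCompactSupport (φ n)) ∧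
      Tendsto (fun n => eLpNorm (fun x => gradient (φ n) x - G x) 2 volume) atTop (𝓝 0) ∧
      Tendsto (fun n => eLpNorm (fun x => φ n x - u x) (sobolevExponent N) volume) atTop (𝓝 0)

/-- The space `D^{1,2}(ℝ^N)`, `N ≥ 3`. -/
def MemD12 {N : ℕ} (u : RN N → ℝ) : Prop := ∃ G : RN N → RN N, HasD12Gradient u G

/-- The set `X` of the Lipschitz functions `u ∈ D^{1,2}(ℝ^N)` with `‖∇u‖_{L^∞} ≤ 1`. A Lipschitz
function is differentiable almost everywhere, and `gradient u` is its almost everywhere gradient. -/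
def spaceX (N : ℕ) : Set (RN N → ℝ) :=
  {u | MemD12 u ∧ (∃ K, LipschitzWith K u) ∧ eLpNorm (gradient u) ∞ volume ≤ 1}

/-- The quotient `‖∇u‖²_{L²} / ‖u‖^N_{L^∞}`, with values in `[0, ∞]`. -/
def energyRatio {N : ℕ} (u : RN N → ℝ) : ℝ≥0∞ :=
  eLpNorm (gradient u) 2 volume ^ 2 / eLpNorm u ∞ volume ^ N

/-- The best constant: the infimum of `‖∇u‖²_{L²} / ‖u‖^N_{L^∞}` over `u ∈ X \ {0}`. -/
def bestConstant (N : ℕ) : ℝ≥0∞ := ⨅ u ∈ spaceX N \ {0}, energyRatio u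

/-- `ω_{N-1}`, the surface measure of the unit sphere of `ℝ^N`. -/
def sphereArea (N : ℕ) : ℝ := (volume : Measure (RN N)).toSphere.real Set.univ

/-- The radius `(N-2)/(N-1)`. -/
def barR (N : ℕ) : ℝ := ((N : ℝ) - 2) / ((N : ℝ) - 1)

/-- The radial function equal to `1 - r` for `r ≤ R` and to `R^{N-2} (1 - R) r^{2-N}` for `r > R`,
where `R = (N-2)/(N-1)` and `r = |x|`. -/
def extremal (N : ℕ) (x : RN N) : ℝ :=
  if ‖x‖ ≤ barR N then 1 - ‖x‖
  else barR N ^ (N - 2) * (1 - barR N) / ‖x‖ ^ (N - 2)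

end

/-! Lower bound: a Lipschitz function in the space vanishes at infinity. Around a point where `u`
equals `m > 0`, almost every ray carries a function `f` with `f 0 = m`, limit `0` and `f' ≥ -1`, and
its squared slope is at most the squared gradient. With `N = n + 2`, it remains to minimise the
integral of `r ^ (n + 1) * f' ^ 2` along a ray. This is a convex problem: with a multiplier `λ`, the
integrand `r ^ (n + 1) * s ^ 2 + 2 * λ * s` is minimised over `s ≥ -1` by `s = -min 1 (λ / r ^ (n +
1))`. The minimiser thus falls with slope `-1` up to a radius `ρ`, and then decays like `r ^ (-n)`.
Integrating the pointwise inequalities gives `ofReal_le_lintegral_pow_mul_deriv_sq`; integrating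
over directions gives the constant.

Attainment: `extremal` has the optimal profile with `m = 1` on every ray, so its energy is the same
constant. Its membership in the space is shown by truncating at small heights, which gives compact
support, and then mollifying (`hasD12Gradient_of_lipschitzWith`). -/

/-! ### Polar coordinates and null sets along rays -/

section Polar

variable {E : Type*} [NormedAddCommGroup E] [NormedSpace ℝ E] [FiniteDimensional ℝ E]
  [MeasurableSpace E] [BorelSpace E] [Nontrivial E] (μ : Measure E) [μ.IsAddHaarMeasure]

/-- Integration in polar coordinates. -/
theorem lintegral_polarCoord {f : E → ℝ≥0∞} (hf : Measurable f) :
    ∫⁻ x, f x ∂μ = ∫⁻ θ : Metric.sphere (0 : E) 1, (∫⁻ r in Set.Ioi (0 : ℝ),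
      ENNReal.ofReal (r ^ (Module.finrank ℝ E - 1)) * f (r • (θ : E))) ∂μ.toSphere := by
  have h1 : ∫⁻ x, f x ∂μ = ∫⁻ x : ({0}ᶜ : Set E), f x ∂(μ.comap (↑)) := by
    rw [lintegral_subtype_comap (measurableSet_singleton _).compl, restrict_compl_singleton]
  have hg : Measurable fun p : Metric.sphere (0 : E) 1 × Set.Ioi (0 : ℝ) =>
      f ((p.2 : ℝ) • (p.1 : E)) := by fun_prop
  have h2 : ∫⁻ x : ({0}ᶜ : Set E), f x ∂(μ.comap (↑)) =
      ∫⁻ p, f ((p.2 : ℝ) • (p.1 : E))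
        ∂(μ.toSphere.prod (Measure.volumeIoiPow (Module.finrank ℝ E - 1))) := by
    rw [← (μ.measurePreserving_homeomorphUnitSphereProd).lintegral_comp hg]
    refine lintegral_congr fun x => ?_
    congr 1
    have : ‖(x : E)‖ ≠ 0 := norm_ne_zero_iff.2 x.2
    simp [smul_smul, this]
  rw [h1, h2, lintegral_prod _ hg.aemeasurable]
  refine lintegral_congr fun θ => ?_
  rw [Measure.volumeIoiPow, lintegral_withDensity_eq_lintegral_mul _ (by fun_prop)
    (by fun_prop)]
  exact lintegral_subtype_comap measurableSet_Ioi
    (fun r : ℝ => ENNReal.ofReal (r ^ (Module.finrank ℝ E - 1)) * f (r • (θ : E)))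

/-- Polar integration of the indicator of a measurable null superset gives zero on almost every ray,
and the weight is positive for `r > 0`. -/
theorem ae_ae_of_ae_polarCoord {p : E → Prop} (h : ∀ᵐ x ∂μ, p x) :
    ∀ᵐ θ : Metric.sphere (0 : E) 1 ∂μ.toSphere,
      ∀ᵐ r ∂(volume.restrict (Set.Ioi (0 : ℝ))), p (r • (θ : E)) := by
  obtain ⟨t, hsub, ht, ht0⟩ := exists_measurable_superset_of_null (ae_iff.1 h)
  have hm : Measurable (t.indicator (1 : E → ℝ≥0∞)) := measurable_one.indicator ht
  have h0 := lintegral_polarCoord μ hm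
  rw [lintegral_indicator_one ht, ht0] at h0
  have hmeas : Measurable fun q : Metric.sphere (0 : E) 1 × ℝ =>
      ENNReal.ofReal (q.2 ^ (Module.finrank ℝ E - 1)) * t.indicator 1 (q.2 • (q.1 : E)) :=
    Measurable.mul (by fun_prop) (hm.comp (by fun_prop))
  rw [eq_comm, lintegral_eq_zero_iff hmeas.lintegral_prod_right'] at h0
  filter_upwards [h0] with θ hθ
  have hmθ : Measurable fun r : ℝ =>
      ENNReal.ofReal (r ^ (Module.finrank ℝ E - 1)) * t.indicator 1 (r • (θ : E)) :=
    Measurable.mul (by fun_prop) (hm.comp (by fun_prop))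
  simp only [Pi.zero_apply] at hθ
  rw [lintegral_eq_zero_iff hmθ] at hθ
  filter_upwards [hθ, ae_restrict_mem measurableSet_Ioi] with r hr hr0
  by_contra hp
  have hpos : (0 : ℝ) < r ^ (Module.finrank ℝ E - 1) := pow_pos hr0 _
  have : r • (θ : E) ∈ t := hsub hp
  simp [this, hpos.not_ge] at hr

end Polar

/-! ### The one-dimensional minimisation problem -/

section Ray

/-- A one-dimensional weighted energy estimate for a Lipschitz function with slope at least `-1`
that vanishes at infinity. -/
theorem ofReal_le_lintegral_pow_mul_deriv_sq {n : ℕ} (hn : 1 ≤ n) {f : ℝ → ℝ} {K : NNReal}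
    (hf : LipschitzWith K f) {m : ℝ} (hm : 0 < m) (h0 : f 0 = m)
    (hd : ∀ᵐ r ∂(volume.restrict (Set.Ioi (0 : ℝ))), -1 ≤ deriv f r)
    (hlim : Tendsto f atTop (𝓝 0)) :
    ENNReal.ofReal (2 / (n + 2 : ℝ) * ((n : ℝ) / (n + 1)) ^ (n + 1) * m ^ (n + 2)) ≤
      ∫⁻ r in Set.Ioi (0 : ℝ), ENNReal.ofReal (r ^ (n + 1) * deriv f r ^ 2) := by
  have hn0 : (0 : ℝ) < n := by exact_mod_cast hn
  -- The argument below gives a lower bound for every positive switching radius; this one maximises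
  -- it. The multiplier is `λ = ρ ^ (n + 1)`.
  set ρ : ℝ := m * ((n : ℝ) / (n + 1)) with hρ
  have hρ0 : 0 < ρ := by positivity
  have hac : ∀ a b, AbsolutelyContinuousOnInterval f a b := fun a b =>
    (hf.lipschitzOnWith).absolutelyContinuousOnInterval
  have h_integrable : ∀ a b, IntervalIntegrable (deriv f) volume a b := fun a b =>
    (hac a b).intervalIntegrable_deriv
  have hbound : ∀ r, ‖deriv f r‖ ≤ K := fun r => norm_deriv_le_of_lipschitz hf
  have hsq : ∀ a b, IntervalIntegrable (fun r => r ^ (n + 1) * deriv f r ^ 2) volume a b := by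
    intro a b
    have h1 : IntervalIntegrable (fun r => deriv f r * deriv f r) volume a b := by
      have hmeas := (measurable_deriv f).aestronglyMeasurable (μ := volume)
      exact ⟨(h_integrable a b).1.mul_bdd hmeas.restrict (Eventually.of_forall hbound),
        (h_integrable a b).2.mul_bdd hmeas.restrict (Eventually.of_forall hbound)⟩
    simpa [sq] using h1.continuousOn_mul (by fun_prop)
  have key : ∀ T, ρ < T →
      2 / (n + 2 : ℝ) * ((n : ℝ) / (n + 1)) ^ (n + 1) * m ^ (n + 2) - 2 * ρ ^ (n + 1) * f T ≤
        ∫ r in (0 : ℝ)..T, r ^ (n + 1) * deriv f r ^ 2 := by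
    intro T hT
    have i1 : ρ ^ (n + 2) / (n + 2) - 2 * ρ ^ (n + 1) * (f ρ - m + ρ) ≤
        ∫ r in (0 : ℝ)..ρ, r ^ (n + 1) * deriv f r ^ 2 := by
      have e : ∫ r in (0 : ℝ)..ρ, (r ^ (n + 1) - 2 * ρ ^ (n + 1) * (deriv f r + 1)) =
          ρ ^ (n + 2) / (n + 2) - 2 * ρ ^ (n + 1) * (f ρ - m + ρ) := by
        rw [intervalIntegral.integral_sub (by simp)
          (((h_integrable _ _).add (by simp)).const_mul _), intervalIntegral.integral_const_mul,
          intervalIntegral.integral_add (h_integrable _ _) (by simp), (hac 0 ρ).integral_deriv_eq_sub, h0]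
        simp
        ring
      rw [← e]
      refine intervalIntegral.integral_mono_ae_restrict hρ0.le
        (IntervalIntegrable.sub (by simp) (((h_integrable _ _).add (by simp)).const_mul _)) (hsq _ _) ?_
      have hd' : ∀ᵐ r ∂(volume.restrict (Set.Icc 0 ρ)), -1 ≤ deriv f r := by
        rw [← Measure.restrict_congr_set Ioc_ae_eq_Icc]
        exact ae_restrict_of_ae_restrict_of_subset Set.Ioc_subset_Ioi_self hd
      filter_upwards [hd', ae_restrict_mem measurableSet_Icc] with r hr hrm
      have hp : r ^ (n + 1) ≤ ρ ^ (n + 1) := pow_le_pow_left₀ hrm.1 hrm.2 _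
      have hp0 : 0 ≤ r ^ (n + 1) := pow_nonneg hrm.1 _
      -- With `s = f'` and `w = r ^ (n + 1) ≤ λ`, the difference of the two sides is `w * (s + 1) ^
      -- 2 + 2 * (λ - w) * (s + 1)`. The slope bound is used only here.
      nlinarith [mul_nonneg hp0 (sq_nonneg (deriv f r + 1)),
        mul_nonneg (sub_nonneg.2 hp) (by linarith : 0 ≤ deriv f r + 1)]
    have i2 : -2 * ρ ^ (n + 1) * (f T - f ρ) - ρ ^ (n + 2) / n ≤
        ∫ r in ρ..T, r ^ (n + 1) * deriv f r ^ 2 := by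
      have h0n : (0 : ℝ) ∉ Set.uIcc ρ T := by
        rw [Set.uIcc_of_le hT.le]; intro h; linarith [h.1]
      have hz : IntervalIntegrable (fun r : ℝ => r ^ (-(n + 1 : ℤ))) volume ρ T :=
        intervalIntegral.intervalIntegrable_zpow (Or.inr h0n)
      have e : ∫ r in ρ..T, (-2 * ρ ^ (n + 1) * deriv f r -
            (ρ ^ (n + 1)) ^ 2 * r ^ (-(n + 1 : ℤ))) =
          -2 * ρ ^ (n + 1) * (f T - f ρ) -
            (ρ ^ (n + 1)) ^ 2 * ((ρ ^ n)⁻¹ - (T ^ n)⁻¹) / n := by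
        rw [intervalIntegral.integral_sub ((h_integrable _ _).const_mul _) (hz.const_mul _),
          intervalIntegral.integral_const_mul, intervalIntegral.integral_const_mul,
          (hac ρ T).integral_deriv_eq_sub, integral_zpow (Or.inr ⟨by omega, h0n⟩)]
        have : (-(n + 1 : ℤ) + 1) = -(n : ℤ) := by ring
        rw [this, zpow_neg, zpow_neg, zpow_natCast, zpow_natCast]
        rw [show ((-(n + 1 : ℤ) : ℤ) : ℝ) + 1 = -(n : ℝ) by push_cast; ring, div_neg]
        ring
      have hT0 : 0 < T := hρ0.trans hT
      have : -2 * ρ ^ (n + 1) * (f T - f ρ) - ρ ^ (n + 2) / n ≤ -2 * ρ ^ (n + 1) * (f T - f ρ) -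
            (ρ ^ (n + 1)) ^ 2 * ((ρ ^ n)⁻¹ - (T ^ n)⁻¹) / n := by
        have h1 : (ρ ^ (n + 1)) ^ 2 * (ρ ^ n)⁻¹ = ρ ^ (n + 2) := by
          field_simp
          ring
        have h2 : 0 ≤ (ρ ^ (n + 1)) ^ 2 * (T ^ n)⁻¹ := by positivity
        rw [mul_sub ((ρ ^ (n + 1)) ^ 2), h1]
        gcongr
        linarith
      refine this.trans ?_
      rw [← e]
      refine intervalIntegral.integral_mono_on hT.le
        (((h_integrable _ _).const_mul _).sub (hz.const_mul _)) (hsq _ _) ?_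
      intro r hr
      have hr0 : 0 < r := hρ0.trans_le hr.1
      have hp : 0 < r ^ (n + 1) := by positivity
      have e2 : r ^ (-(n + 1 : ℤ)) = (r ^ (n + 1))⁻¹ := by
        rw [zpow_neg]; norm_cast
      rw [e2]
      -- Beyond `ρ` the constraint is inactive: completing the square suffices, with equality when
      -- `r ^ (n + 1) * f'` is the constant `-λ`.
      have : 0 ≤ (r ^ (n + 1) * deriv f r + ρ ^ (n + 1)) ^ 2 * (r ^ (n + 1))⁻¹ := by positivity
      have e3 : (r ^ (n + 1) * deriv f r + ρ ^ (n + 1)) ^ 2 * (r ^ (n + 1))⁻¹ =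
        r ^ (n + 1) * deriv f r ^ 2 + 2 * ρ ^ (n + 1) * deriv f r +
          (ρ ^ (n + 1)) ^ 2 * (r ^ (n + 1))⁻¹ := by
        generalize r ^ (n + 1) = b at hp
        field_simp
        ring
      linarith
    rw [← intervalIntegral.integral_add_adjacent_intervals (hsq 0 ρ) (hsq ρ T)]
    -- The unknown value `f ρ` cancels between `i1` and `i2` because both use the same multiplier.
    have e : 2 / (n + 2 : ℝ) * ((n : ℝ) / (n + 1)) ^ (n + 1) * m ^ (n + 2) =
        2 * m * ρ ^ (n + 1) - 2 * ρ * ρ ^ (n + 1) + ρ * ρ ^ (n + 1) / (n + 2)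
          - ρ * ρ ^ (n + 1) / n := by
      rw [hρ, mul_pow, pow_succ m (n + 1)]
      generalize m ^ (n + 1) = a
      generalize ((n : ℝ) / (n + 1)) ^ (n + 1) = b
      field_simp
      ring
    rw [e]
    have := pow_succ ρ (n + 1)
    rw [this] at i1 i2
    linear_combination i1 + i2
  have hlim' : Tendsto (fun T => ENNReal.ofReal
      (2 / (n + 2 : ℝ) * ((n : ℝ) / (n + 1)) ^ (n + 1) * m ^ (n + 2) - 2 * ρ ^ (n + 1) * f T))
      atTop (𝓝 (ENNReal.ofReal
        (2 / (n + 2 : ℝ) * ((n : ℝ) / (n + 1)) ^ (n + 1) * m ^ (n + 2)))) := by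
    refine ENNReal.tendsto_ofReal ?_
    simpa using tendsto_const_nhds.sub (hlim.const_mul (2 * ρ ^ (n + 1)))
  refine le_of_tendsto hlim' ?_
  filter_upwards [eventually_gt_atTop ρ] with T hT
  refine (ENNReal.ofReal_le_ofReal (key T hT)).trans ?_
  have hT0 : 0 ≤ T := (hρ0.trans hT).le
  rw [intervalIntegral.integral_of_le hT0, ofReal_integral_eq_lintegral_ofReal (hsq 0 T).1]
  · exact lintegral_mono_set Set.Ioc_subset_Ioi_self
  · filter_upwards [ae_restrict_mem measurableSet_Ioc] with r hr
    have := hr.1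
    positivity

end Ray

/-! ### The sharp lower bound -/

section LowerBound

theorem measurable_gradient {N : ℕ} (u : RN N → ℝ) : Measurable (gradient u) :=
  (InnerProductSpace.toDual ℝ (RN N)).symm.continuous.measurable.comp (measurable_fderiv ℝ u)

theorem eLpNorm_two_pow_two {α E : Type*} [MeasurableSpace α] [NormedAddCommGroup E]
    (μ : Measure α) (f : α → E) : eLpNorm f 2 μ ^ 2 = ∫⁻ x, ‖f x‖ₑ ^ 2 ∂μ := by
  have := eLpNorm_nnreal_pow_eq_lintegral (p := 2) (μ := μ) (f := f) (by norm_num)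
  simpa using this

theorem sobolevExponent_ne_zero {N : ℕ} (hN : 3 ≤ N) : sobolevExponent N ≠ 0 := by
  have : (3 : ℝ) ≤ N := by exact_mod_cast hN
  have h : 0 < 2 * (N : ℝ) / ((N : ℝ) - 2) := div_pos (by linarith) (by linarith)
  simpa [sobolevExponent] using h

theorem sobolevExponent_ne_top (N : ℕ) : sobolevExponent N ≠ ⊤ := ENNReal.ofReal_ne_top

/-- If `|u x| ≥ ε`, the Lipschitz bound keeps `|u| ≥ ε / 2` on a ball of fixed radius `δ`. Away from
the support of `φ n` this ball lies in the set where `φ n` and `u` differ by at least `ε / 2`, whose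
measure is eventually smaller than the ball's. -/
theorem HasD12Gradient.tendsto_cocompact {N : ℕ} (hN : 3 ≤ N) {u : RN N → ℝ} {G : RN N → RN N}
    (h : HasD12Gradient u G) {K : NNReal} (hu : LipschitzWith K u) :
    Tendsto u (cocompact (RN N)) (𝓝 0) := by
  obtain ⟨hum, -, φ, hφ, -, hlim⟩ := h
  have hmeas : TendstoInMeasure volume φ atTop u :=
    tendstoInMeasure_of_tendsto_eLpNorm (sobolevExponent_ne_zero hN)
      (fun n => (hφ n).1.continuous.aestronglyMeasurable) hum hlim
  rw [Metric.tendsto_nhds]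
  intro ε hε
  set δ : ℝ := ε / (2 * (K + 1)) with hδ
  have hδ0 : 0 < δ := by positivity
  have hKδ : K * δ ≤ ε / 2 := by
    rw [hδ, mul_div_assoc', div_le_div_iff₀ (by positivity) (by positivity)]
    nlinarith [K.coe_nonneg]
  have hball : (0 : ℝ≥0∞) < volume (Metric.ball (0 : RN N) δ) := Metric.measure_ball_pos _ _ hδ0
  have h1 := (tendstoInMeasure_iff_dist.1 hmeas) (ε / 2) (by positivity)
  obtain ⟨n, hn⟩ := (h1.eventually_lt_const hball).exists
  have hcpt : IsCompact (Metric.cthickening δ (tsupport (φ n))) := (hφ n).2.cthickening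
  filter_upwards [hcpt.compl_mem_cocompact] with x hx
  by_contra! hge
  rw [dist_zero_right, Real.norm_eq_abs] at hge
  refine absurd hn (not_lt.2 ?_)
  have hvol : volume (Metric.ball (0 : RN N) δ) = volume (Metric.ball x δ) := by
    rw [Measure.addHaar_ball_center volume x]
  rw [hvol]
  refine measure_mono fun y hy => ?_
  have hyx : dist y x < δ := hy
  have hφ0 : φ n y = 0 := by
    by_contra h0
    exact hx (Metric.mem_cthickening_of_dist_le x y δ _ (subset_tsupport _ h0)
      (by rw [dist_comm]; exact hyx.le))
  have h2 := hu.dist_le_mul y x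
  have h3 : dist (u y) (u x) ≤ ε / 2 :=
    h2.trans ((mul_le_mul_of_nonneg_left hyx.le K.coe_nonneg).trans hKδ)
  rw [Real.dist_eq] at h3
  simp only [Set.mem_ofPred_eq, hφ0, Real.dist_eq, zero_sub, abs_neg]
  have := abs_sub_abs_le_abs_sub (u x) (u y)
  rw [abs_sub_comm] at this
  linarith

/-- The energy is written in polar coordinates centred at `x₀`, and the radial derivative, dominated
by the gradient, obeys the ray estimate in almost every direction. -/
theorem ofReal_le_eLpNorm_gradient_of_pos {n : ℕ} (hn : 1 ≤ n) {u : RN (n + 2) → ℝ} {K : NNReal}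
    (hu : LipschitzWith K u) (hlim : Tendsto u (cocompact _) (𝓝 0))
    (hgrad : ∀ᵐ x, ‖gradient u x‖ ≤ 1) (x₀ : RN (n + 2)) (hpos : 0 < u x₀) :
    ENNReal.ofReal (2 / (n + 2 : ℝ) * ((n : ℝ) / (n + 1)) ^ (n + 1) * u x₀ ^ (n + 2)) *
      (volume : Measure (RN (n + 2))).toSphere Set.univ ≤ eLpNorm (gradient u) 2 volume ^ 2 := by
  rw [eLpNorm_two_pow_two, ← lintegral_add_left_eq_self _ x₀, lintegral_polarCoord volume
    (f := fun y => ‖gradient u (x₀ + y)‖ₑ ^ 2)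
    (((measurable_gradient u).comp (measurable_const_add x₀)).enorm.pow_const 2),
    ← lintegral_const]
  have hae : ∀ᵐ y : RN (n + 2), DifferentiableAt ℝ u (x₀ + y) ∧ ‖gradient u (x₀ + y)‖ ≤ 1 :=
    (measurePreserving_add_left volume x₀).quasiMeasurePreserving.ae
      (hu.ae_differentiableAt.and hgrad)
  refine lintegral_mono_ae ?_
  filter_upwards [ae_ae_of_ae_polarCoord volume hae] with θ hθ
  have hθ1 : ‖(θ : RN (n + 2))‖ = 1 := by simp
  set f : ℝ → ℝ := fun r => u (x₀ + r • (θ : RN (n + 2))) with hf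
  have hderiv : ∀ r, DifferentiableAt ℝ u (x₀ + r • (θ : RN (n + 2))) →
      |deriv f r| ≤ ‖gradient u (x₀ + r • (θ : RN (n + 2)))‖ := by
    intro r hr
    have h1 : HasDerivAt (fun r : ℝ => x₀ + r • (θ : RN (n + 2))) (θ : RN (n + 2)) r := by
      simpa using ((hasDerivAt_id r).smul_const (θ : RN (n + 2))).const_add x₀
    have h2 := hr.hasFDerivAt.comp_hasDerivAt r h1
    have h3 : deriv f r = fderiv ℝ u (x₀ + r • (θ : RN (n + 2))) θ := h2.deriv
    rw [h3, gradient, LinearIsometryEquiv.norm_map, ← Real.norm_eq_abs]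
    simpa [hθ1] using (fderiv ℝ u (x₀ + r • (θ : RN (n + 2)))).le_opNorm θ
  have hfl : LipschitzWith K f := by
    refine LipschitzWith.of_dist_le_mul fun a b => (hu.dist_le_mul _ _).trans ?_
    rw [dist_add_left, dist_eq_norm, ← sub_smul, norm_smul, hθ1, mul_one, Real.dist_eq,
      Real.norm_eq_abs]
  have hfar : Tendsto (fun r : ℝ => x₀ + r • (θ : RN (n + 2))) atTop (cocompact _) := by
    rw [← Metric.cobounded_eq_cocompact, ← tendsto_norm_atTop_iff_cobounded]
    refine tendsto_atTop_mono' _ (f₁ := fun r : ℝ => r - ‖x₀‖) ?_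
      (tendsto_atTop_add_const_right _ _ tendsto_id)
    filter_upwards [eventually_ge_atTop 0] with r hr
    have := norm_sub_le (x₀ + r • (θ : RN (n + 2))) x₀
    rw [add_sub_cancel_left, norm_smul, hθ1, mul_one, Real.norm_of_nonneg hr] at this
    linarith
  have key := ofReal_le_lintegral_pow_mul_deriv_sq hn hfl hpos (by simp [hf])
    (hθ.mono fun r hr => (abs_le.1 ((hderiv r hr.1).trans hr.2)).1) (hlim.comp hfar)
  refine key.trans (lintegral_mono_ae ?_)
  filter_upwards [hθ, ae_restrict_mem measurableSet_Ioi] with r hr hr0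
  have hr1 : 0 ≤ r ^ (n + 1) := pow_nonneg (le_of_lt hr0) _
  rw [ENNReal.ofReal_mul hr1, finrank_euclideanSpace_fin]
  refine mul_le_mul' le_rfl ?_
  rw [← sq_abs, ENNReal.ofReal_pow (abs_nonneg _), ← ofReal_norm]
  gcongr
  exact hderiv r hr.1

theorem gradient_neg_fun {N : ℕ} (u : RN N → ℝ) (x : RN N) :
    gradient (fun y => -u y) x = -gradient u x := by
  simp [gradient, fderiv_fun_neg]

/-- The value of the best constant. -/
noncomputable def sharpConstant (N : ℕ) : ℝ :=
  2 / (N : ℝ) * (((N : ℝ) - 2) / ((N : ℝ) - 1)) ^ (N - 1) * sphereArea N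

theorem sphereArea_pos {N : ℕ} (hN : 3 ≤ N) : 0 < sphereArea N := by
  have : Nonempty (Fin N) := ⟨⟨0, by omega⟩⟩
  refine ENNReal.toReal_pos ?_ (measure_ne_top _ _)
  rw [Measure.toSphere_apply_univ, finrank_euclideanSpace_fin]
  exact mul_ne_zero (by simp; omega) (Metric.measure_ball_pos _ _ one_pos).ne'

theorem sharpConstant_pos {N : ℕ} (hN : 3 ≤ N) : 0 < sharpConstant N := by
  have h3 : (3 : ℝ) ≤ N := by exact_mod_cast hN
  have := sphereArea_pos hN
  have h : 0 < ((N : ℝ) - 2) / ((N : ℝ) - 1) := div_pos (by linarith) (by linarith)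
  unfold sharpConstant
  positivity

theorem sharpConstant_mul_enorm_pow_le {N : ℕ} (hN : 3 ≤ N) {u : RN N → ℝ} {K : NNReal}
    (hu : LipschitzWith K u) (hlim : Tendsto u (cocompact _) (𝓝 0))
    (hgrad : ∀ᵐ x, ‖gradient u x‖ ≤ 1) (x₀ : RN N) :
    ENNReal.ofReal (sharpConstant N) * ‖u x₀‖ₑ ^ N ≤ eLpNorm (gradient u) 2 volume ^ 2 := by
  obtain ⟨n, rfl⟩ : ∃ n, N = n + 2 := ⟨N - 2, by omega⟩
  have hn : 1 ≤ n := by omega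
  have hS : (volume : Measure (RN (n + 2))).toSphere Set.univ =
      ENNReal.ofReal (sphereArea (n + 2)) := by
    rw [sphereArea, ofReal_measureReal]
  have hrw : ∀ m : ℝ, 0 ≤ m → ENNReal.ofReal (sharpConstant (n + 2)) * ENNReal.ofReal m ^ (n + 2) =
      ENNReal.ofReal (2 / (n + 2 : ℝ) * ((n : ℝ) / (n + 1)) ^ (n + 1) * m ^ (n + 2)) *
        ENNReal.ofReal (sphereArea (n + 2)) := by
    intro m hm
    rw [← ENNReal.ofReal_pow hm, ← ENNReal.ofReal_mul (sharpConstant_pos hN).le,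
      ← ENNReal.ofReal_mul (by positivity), sharpConstant]
    congr 1
    push_cast
    rw [show (n : ℝ) + 2 - 2 = n by ring, show (n : ℝ) + 2 - 1 = n + 1 by ring]
    ring
  rcases lt_trichotomy (u x₀) 0 with h | h | h
  · have h1 := ofReal_le_eLpNorm_gradient_of_pos hn (u := fun y => -u y) (K := K) hu.neg
      (by simpa using hlim.neg) (by simpa [gradient_neg_fun] using hgrad) x₀ (by linarith)
    rw [hS, ← hrw _ (by linarith)] at h1
    have h2 : eLpNorm (gradient fun y => -u y) 2 volume = eLpNorm (gradient u) 2 volume := by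
      rw [← eLpNorm_neg]
      congr 1
      ext1 x
      simp [gradient_neg_fun]
    rwa [h2, ← abs_of_neg h, ← Real.norm_eq_abs, ofReal_norm] at h1
  · simp [h]
  · have h1 := ofReal_le_eLpNorm_gradient_of_pos hn hu hlim hgrad x₀ h
    rwa [hS, ← hrw _ h.le, ← abs_of_pos h, ← Real.norm_eq_abs, ofReal_norm] at h1

theorem sharpConstant_mul_eLpNorm_top_pow_le {N : ℕ} (hN : 3 ≤ N) {u : RN N → ℝ}
    (hu : u ∈ spaceX N) :
    ENNReal.ofReal (sharpConstant N) * eLpNorm u ∞ volume ^ N ≤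
      eLpNorm (gradient u) 2 volume ^ 2 := by
  obtain ⟨⟨G, hG⟩, ⟨K, hK⟩, hgrad⟩ := hu
  have hgrad' : ∀ᵐ x, ‖gradient u x‖ ≤ 1 := by
    rw [eLpNorm_exponent_top] at hgrad
    filter_upwards [enorm_ae_le_eLpNormEssSup (gradient u) volume] with x hx
    have := hx.trans hgrad
    rwa [← ofReal_norm, ENNReal.ofReal_le_one] at this
  have hpt := sharpConstant_mul_enorm_pow_le hN hK (hG.tendsto_cocompact hN hK) hgrad'
  have hc0 : ENNReal.ofReal (sharpConstant N) ≠ 0 := by simpa using sharpConstant_pos hN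
  have hN0 : N ≠ 0 := by omega
  set E := eLpNorm (gradient u) 2 volume ^ 2
  have hle : eLpNorm u ∞ volume ≤ (E / ENNReal.ofReal (sharpConstant N)) ^ (N : ℝ)⁻¹ := by
    rw [eLpNorm_exponent_top]
    -- The pointwise estimate is solved for `‖u x‖ₑ`, so that it passes to the essential supremum.
    refine eLpNormEssSup_le_of_ae_enorm_bound (Eventually.of_forall fun x => ?_)
    rw [ENNReal.le_rpow_inv_iff (by positivity), ENNReal.rpow_natCast,
      ENNReal.le_div_iff_mul_le (.inl hc0) (.inl ENNReal.ofReal_ne_top), mul_comm]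
    exact hpt x
  rw [ENNReal.le_rpow_inv_iff (by positivity), ENNReal.rpow_natCast,
      ENNReal.le_div_iff_mul_le (.inl hc0) (.inl ENNReal.ofReal_ne_top), mul_comm] at hle
  exact hle

theorem eLpNorm_top_ne_top_of_mem_spaceX {N : ℕ} (hN : 3 ≤ N) {u : RN N → ℝ}
    (hu : u ∈ spaceX N) : eLpNorm u ∞ volume ≠ ⊤ := by
  obtain ⟨⟨G, hG⟩, ⟨K, hK⟩, -⟩ := hu
  let v : ZeroAtInftyContinuousMap (RN N) ℝ := ⟨⟨u, hK.continuous⟩, hG.tendsto_cocompact hN hK⟩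
  exact (memLp_top_of_bound hK.continuous.aestronglyMeasurable ‖v.toBCF‖
    (Eventually.of_forall fun x => v.toBCF.norm_coe_le_norm x)).eLpNorm_ne_top

theorem eLpNorm_top_ne_zero_of_continuous {N : ℕ} {u : RN N → ℝ} (hu : Continuous u)
    (h0 : u ≠ 0) : eLpNorm u ∞ volume ≠ 0 := by
  rw [Ne, eLpNorm_eq_zero_iff hu.aestronglyMeasurable (by simp)]
  exact fun h => h0 ((hu.ae_eq_iff_eq volume continuous_zero).1 h)

theorem sharpConstant_le_energyRatio {N : ℕ} (hN : 3 ≤ N) {u : RN N → ℝ}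
    (hu : u ∈ spaceX N \ {0}) : ENNReal.ofReal (sharpConstant N) ≤ energyRatio u := by
  have hc : Continuous u := hu.1.2.1.choose_spec.continuous
  rw [energyRatio, ENNReal.le_div_iff_mul_le
    (.inl (pow_ne_zero _ (eLpNorm_top_ne_zero_of_continuous hc hu.2)))
    (.inl (ENNReal.pow_ne_top (eLpNorm_top_ne_top_of_mem_spaceX hN hu.1)))]
  exact sharpConstant_mul_eLpNorm_top_pow_le hN hu.1

end LowerBound

/-! ### Approximation by mollification -/

section Mollification

open scoped Convolution

theorem tendsto_eLpNorm_zero_of_dominated {α F : Type*} [MeasurableSpace α] {μ : Measure α}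
    [NormedAddCommGroup F] {p : ℝ≥0∞} (hp0 : p ≠ 0) (hp : p ≠ ⊤) {f : ℕ → α → F} {h : α → ℝ}
    (hf : ∀ n, AEStronglyMeasurable (f n) μ) (hh : MemLp h p μ)
    (hle : ∀ n, ∀ᵐ x ∂μ, ‖f n x‖ ≤ ‖h x‖)
    (hlim : ∀ᵐ x ∂μ, Tendsto (fun n => f n x) atTop (𝓝 0)) :
    Tendsto (fun n => eLpNorm (f n) p μ) atTop (𝓝 0) := by
  have hpr : 0 < p.toReal := ENNReal.toReal_pos hp0 hp
  simp_rw [eLpNorm_eq_lintegral_rpow_enorm_toReal hp0 hp]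
  have key : Tendsto (fun n => ∫⁻ x, ‖f n x‖ₑ ^ p.toReal ∂μ) atTop (𝓝 (∫⁻ _, 0 ∂μ)) := by
    refine tendsto_lintegral_of_dominated_convergence' (fun x => ‖h x‖ₑ ^ p.toReal)
      (fun n => (hf n).enorm.pow_const _) (fun n => ?_)
      (lintegral_rpow_enorm_lt_top_of_eLpNorm_lt_top hp0 hp hh.2).ne ?_
    · filter_upwards [hle n] with x hx
      gcongr
      exact enorm_le_iff_norm_le.2 hx
    · filter_upwards [hlim] with x hx
      have := (ENNReal.continuous_rpow_const (y := p.toReal)).tendsto _ |>.comp hx.enorm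
      simpa [Function.comp_def, hpr] using this
  rw [lintegral_zero] at key
  have := (ENNReal.continuous_rpow_const (y := 1 / p.toReal)).tendsto _ |>.comp key
  simpa [Function.comp_def, hpr] using this

variable {N : ℕ} {F : Type*} [NormedAddCommGroup F] [NormedSpace ℝ F]

/-- A sequence of bump functions concentrating at the origin. -/
noncomputable def shrinkingBump (N n : ℕ) : ContDiffBump (0 : RN N) where
  rIn := 1 / (2 * (n + 1))
  rOut := 1 / (n + 1)
  rIn_pos := by positivity
  rIn_lt_rOut := by
    rw [div_lt_div_iff₀ (by positivity) (by positivity)]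
    linarith [(by positivity : (0 : ℝ) < n + 1)]

/-- The `n`-th mollification of `g`. -/
noncomputable def mollify (n : ℕ) (g : RN N → F) : RN N → F :=
  (shrinkingBump N n).normed volume ⋆[ContinuousLinearMap.lsmul ℝ ℝ, volume] g

theorem norm_mollify_le (n : ℕ) {g : RN N → F} {C : ℝ} (hC : ∀ x, ‖g x‖ ≤ C) (x : RN N) :
    ‖mollify n g x‖ ≤ C := by
  have h := norm_integral_le_of_norm_le (μ := volume)
    (f := fun t => (shrinkingBump N n).normed volume t • g (x - t))
    ((shrinkingBump N n).integrable_normed.mul_const C) (Eventually.of_forall fun t => by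
      rw [norm_smul, Real.norm_of_nonneg ((shrinkingBump N n).nonneg_normed t)]
      exact mul_le_mul_of_nonneg_left (hC _) ((shrinkingBump N n).nonneg_normed t))
  rwa [integral_mul_const, ContDiffBump.integral_normed, one_mul] at h

theorem mollify_eq_zero (n : ℕ) {g : RN N → F} {S : Set (RN N)} (hg : Function.support g ⊆ S)
    {x : RN N} (hx : x ∉ Metric.cthickening 1 S) : mollify n g x = 0 := by
  by_contra h
  obtain ⟨y, hy, z, hz, rfl⟩ := support_convolution_subset _ (Function.mem_support.2 h)
  rw [ContDiffBump.support_normed_eq] at hy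
  refine hx (Metric.mem_cthickening_of_dist_le _ z 1 S (hg hz) ?_)
  have h1 : ‖y‖ < 1 / ((n : ℝ) + 1) := mem_ball_zero_iff.1 hy
  have h2 : 1 / ((n : ℝ) + 1) ≤ 1 := by
    rw [div_le_one (by positivity)]; linarith [n.cast_nonneg (α := ℝ)]
  simpa [dist_eq_norm] using h1.le.trans h2

/-- Dominated convergence: the differences are at most `2 * C` and live on the `1`-thickening of
`S`, and almost everywhere convergence is Lebesgue differentiation. Continuity of `g` is not
assumed, so this applies to `fderiv ℝ u`. -/
theorem tendsto_eLpNorm_mollify_sub [CompleteSpace F] {p : ℝ≥0∞} (hp0 : p ≠ 0) (hp : p ≠ ⊤) {g : RN N → F}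
    (hgm : StronglyMeasurable g) {C : ℝ} (hC : ∀ x, ‖g x‖ ≤ C) {S : Set (RN N)} (hS : IsCompact S)
    (hg : Function.support g ⊆ S) :
    Tendsto (fun n => eLpNorm (fun x => mollify n g x - g x) p volume) atTop (𝓝 0) := by
  have hS' : IsCompact (Metric.cthickening 1 S) := hS.cthickening
  have hC0 : 0 ≤ C := (norm_nonneg _).trans (hC 0)
  have hgl : LocallyIntegrable g volume := by
    refine (Integrable.mono' (g := S.indicator fun _ => C) ?_ hgm.aestronglyMeasurable
      (Eventually.of_forall fun x => ?_)).locallyIntegrable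
    · exact (integrable_indicator_iff hS.measurableSet).2 (integrableOn_const hS.measure_ne_top)
    · by_cases hx : x ∈ S
      · simpa [hx] using hC x
      · have : g x = 0 := by
          by_contra h0
          exact hx (hg h0)
        simp [hx, this]
  refine tendsto_eLpNorm_zero_of_dominated hp0 hp (h := (Metric.cthickening 1 S).indicator
    fun _ => 2 * C) (fun n => ?_)
    (memLp_indicator_const p hS'.measurableSet _ (Or.inr hS'.measure_ne_top)) (fun n => ?_) ?_
  · refine AEStronglyMeasurable.sub ?_ hgm.aestronglyMeasurable
    exact ((shrinkingBump N n).hasCompactSupport_normed.continuous_convolution_left _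
      (shrinkingBump N n).continuous_normed hgl).aestronglyMeasurable
  · refine Eventually.of_forall fun x => ?_
    by_cases hx : x ∈ Metric.cthickening 1 S
    · rw [Set.indicator_of_mem hx, Real.norm_of_nonneg (by positivity)]
      linarith [norm_sub_le (mollify n g x) (g x), hC x, norm_mollify_le n hC x]
    · have : g x = 0 := by
        by_contra h0
        exact hx (Metric.self_subset_cthickening S (hg h0))
      simp [mollify_eq_zero n hg hx, this]
  · have h1 : Tendsto (fun n => (shrinkingBump N n).rOut) atTop (𝓝 0) :=
      tendsto_one_div_add_atTop_nhds_zero_nat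
    have h2 : ∀ᶠ n in atTop, (shrinkingBump N n).rOut ≤ 2 * (shrinkingBump N n).rIn :=
      Eventually.of_forall fun n => by
        simp only [shrinkingBump]
        field_simp
        rfl
    filter_upwards [ContDiffBump.ae_convolution_tendsto_right_of_locallyIntegrable (μ := volume)
      h1 h2 hgl] with x hx
    simpa [mollify] using hx.sub_const (g x)

/-- Rademacher's theorem gives the derivative of the integrand for almost every `t`, and the
Lipschitz constant dominates the difference quotients. -/
theorem hasFDerivAt_mollify (n : ℕ) {u : RN N → ℝ} {K : NNReal} (hu : LipschitzWith K u)
    (x : RN N) : HasFDerivAt (mollify n u) (mollify n (fderiv ℝ u) x) x := by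
  set ψ := (shrinkingBump N n).normed volume with hψ
  have hψc : Continuous ψ := (shrinkingBump N n).continuous_normed
  have hψi : Integrable ψ := (shrinkingBump N n).integrable_normed
  have hψs : HasCompactSupport ψ := (shrinkingBump N n).hasCompactSupport_normed
  refine (hasFDerivAt_integral_of_dominated_loc_of_lip (μ := volume) (s := Set.univ)
    (F := fun x t => ψ t • u (x - t)) (F' := fun t => ψ t • fderiv ℝ u (x - t))
    (bound := fun t => ψ t * K) univ_mem ?_ ?_ ?_ ?_ (hψi.mul_const _) ?_).2
  · exact Eventually.of_forall fun y =>
      (hψc.smul (hu.continuous.comp (by fun_prop))).aestronglyMeasurable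
  · exact (hψc.smul (hu.continuous.comp (by fun_prop))).integrable_of_hasCompactSupport
      hψs.smul_right
  · refine hψc.aestronglyMeasurable.smul ?_
    exact ((measurable_fderiv ℝ u).comp (by fun_prop)).aestronglyMeasurable
  · refine Eventually.of_forall fun t => LipschitzOnWith.of_dist_le_mul fun y _ z _ => ?_
    have h0 : 0 ≤ ψ t := (shrinkingBump N n).nonneg_normed t
    have h1 := hu.dist_le_mul (y - t) (z - t)
    rw [dist_sub_right] at h1
    rw [dist_smul₀, Real.norm_of_nonneg h0, Real.coe_nnabs, abs_of_nonneg (by positivity),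
      mul_assoc]
    exact mul_le_mul_of_nonneg_left h1 h0
  · have hae : ∀ᵐ t, DifferentiableAt ℝ u (x - t) :=
      (quasiMeasurePreserving_sub_left volume x).ae hu.ae_differentiableAt
    filter_upwards [hae] with t ht
    have h1 : HasFDerivAt (fun y : RN N => y - t) (ContinuousLinearMap.id ℝ (RN N)) x :=
      (hasFDerivAt_id x).sub_const t
    exact (ht.hasFDerivAt.comp x h1).const_smul (ψ t)

theorem exists_contDiff_hasCompactSupport_eLpNorm_lt {p : ℝ≥0∞} (hp0 : p ≠ 0) (hp : p ≠ ⊤)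
    {u : RN N → ℝ} {K : NNReal} (hu : LipschitzWith K u) (hc : HasCompactSupport u) {ε : ℝ≥0∞}
    (hε : 0 < ε) : ∃ φ : RN N → ℝ, ContDiff ℝ ∞ φ ∧ HasCompactSupport φ ∧
      eLpNorm (fun x => gradient φ x - gradient u x) 2 volume < ε ∧
      eLpNorm (fun x => φ x - u x) p volume < ε := by
  obtain ⟨C, hC⟩ := hc.exists_bound_of_continuous hu.continuous
  have h1 := tendsto_eLpNorm_mollify_sub hp0 hp hu.continuous.stronglyMeasurable hC hc.isCompact
    (subset_tsupport u)
  have h2 := tendsto_eLpNorm_mollify_sub (p := 2) (by simp) (by simp)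
    (measurable_fderiv ℝ u).stronglyMeasurable
    (fun x => norm_fderiv_le_of_lipschitz ℝ hu) hc.isCompact (support_fderiv_subset ℝ)
  obtain ⟨n, hn1, hn2⟩ := ((h1.eventually_lt_const hε).and (h2.eventually_lt_const hε)).exists
  refine ⟨mollify n u, ?_, ?_, ?_, hn1⟩
  · exact (shrinkingBump N n).hasCompactSupport_normed.contDiff_convolution_left _
      (shrinkingBump N n).contDiff_normed hu.continuous.locallyIntegrable
  · exact (shrinkingBump N n).hasCompactSupport_normed.convolution _ hc
  · refine lt_of_eq_of_lt (eLpNorm_congr_norm_ae (Eventually.of_forall fun x => ?_)) hn2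
    rw [gradient, gradient, ← map_sub, LinearIsometryEquiv.norm_map,
      (hasFDerivAt_mollify n hu x).fderiv]

end Mollification

/-! ### Truncation and membership in the energy space -/

section Truncation

variable {N : ℕ}

theorem gradient_eq_zero_of_isLocalMin {u : RN N → ℝ} {x : RN N} (h : IsLocalMin u x) :
    gradient u x = 0 := by
  simp [gradient, h.fderiv_eq_zero]

/-- The truncation has a global minimum at `x`. This also covers `u x = δ`, where it may fail to be
differentiable and `gradient` is `0` by convention. -/
theorem gradient_truncate_of_le {u : RN N → ℝ} {δ : ℝ} {x : RN N} (h : u x ≤ δ) :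
    gradient (fun y => max (u y - δ) 0) x = 0 := by
  refine gradient_eq_zero_of_isLocalMin (Eventually.of_forall fun y => ?_)
  change max (u x - δ) 0 ≤ max (u y - δ) 0
  rw [max_eq_right (sub_nonpos.2 h)]
  exact le_max_right _ _

theorem gradient_truncate_of_lt {u : RN N → ℝ} (hu : Continuous u) {δ : ℝ} {x : RN N}
    (h : δ < u x) : gradient (fun y => max (u y - δ) 0) x = gradient u x := by
  have : (fun y => max (u y - δ) 0) =ᶠ[𝓝 x] fun y => u y - δ := by
    filter_upwards [hu.continuousAt.eventually_const_lt h] with y hy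
    exact max_eq_left (by linarith)
  rw [gradient, gradient, this.fderiv_eq, fderiv_sub_const]

theorem hasCompactSupport_truncate {u : RN N → ℝ} (hlim : Tendsto u (cocompact _) (𝓝 0))
    {δ : ℝ} (hδ : 0 < δ) : HasCompactSupport fun y => max (u y - δ) 0 := by
  obtain ⟨K, hK, hKu⟩ := (hasBasis_cocompact.eventually_iff).1 (hlim.eventually_lt_const hδ)
  refine HasCompactSupport.intro hK fun x hx => ?_
  exact max_eq_right (by linarith [hKu hx])

/-- The truncations `max (u - δ) 0` have compact support by decay and converge to `u` by dominated
convergence; each is then mollified with error below `δ`. -/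
theorem hasD12Gradient_of_lipschitzWith (hN : 3 ≤ N) {u : RN N → ℝ} {K : NNReal}
    (hu : LipschitzWith K u) (hnonneg : ∀ x, 0 ≤ u x) (hlim : Tendsto u (cocompact _) (𝓝 0))
    (hLp : MemLp u (sobolevExponent N) volume) (hgrad : MemLp (gradient u) 2 volume) :
    HasD12Gradient u (gradient u) := by
  set δ : ℕ → ℝ := fun k => 1 / ((k : ℝ) + 1) with hδ
  have hδ0 : ∀ k, 0 < δ k := fun k => by positivity
  have hδlim : Tendsto δ atTop (𝓝 0) := tendsto_one_div_add_atTop_nhds_zero_nat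
  set v : ℕ → RN N → ℝ := fun k y => max (u y - δ k) 0 with hv
  have hvl : ∀ k, LipschitzWith K (v k) := fun k => by
    have := (hu.sub (LipschitzWith.const (δ k))).max_const 0
    rwa [add_zero] at this
  have hgconv : Tendsto (fun k => eLpNorm (fun x => gradient (v k) x - gradient u x) 2 volume)
      atTop (𝓝 0) := by
    refine tendsto_eLpNorm_zero_of_dominated (by simp) (by simp) (h := fun x => ‖gradient u x‖)
      (fun k => ((measurable_gradient _).sub (measurable_gradient _)).aestronglyMeasurable)
      hgrad.norm (fun k => Eventually.of_forall fun x => ?_) (Eventually.of_forall fun x => ?_)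
    · rcases le_or_gt (u x) (δ k) with h | h
      · simp [hv, gradient_truncate_of_le h]
      · simp [hv, gradient_truncate_of_lt hu.continuous h]
    -- Zeros of `u` are minima, so both gradients vanish there; where `u x > 0`, the gradients
    -- eventually agree.
    · rcases (hnonneg x).eq_or_lt with h | h
      · have h1 : gradient u x = 0 :=
          gradient_eq_zero_of_isLocalMin (Eventually.of_forall fun y => h ▸ hnonneg y)
        simp [hv, h1, gradient_truncate_of_le (h ▸ (hδ0 _).le)]
      · refine tendsto_const_nhds.congr' ?_
        filter_upwards [hδlim.eventually_lt_const h] with k hk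
        simp [hv, gradient_truncate_of_lt hu.continuous hk]
  have hconv : Tendsto (fun k => eLpNorm (fun x => v k x - u x) (sobolevExponent N) volume)
      atTop (𝓝 0) := by
    refine tendsto_eLpNorm_zero_of_dominated (sobolevExponent_ne_zero hN)
      (sobolevExponent_ne_top N) (h := u)
      (fun k => ((hvl k).continuous.sub hu.continuous).aestronglyMeasurable) hLp
      (fun k => Eventually.of_forall fun x => ?_) (Eventually.of_forall fun x => ?_)
    · rw [Real.norm_eq_abs, Real.norm_of_nonneg (hnonneg x), abs_le]
      constructor
      · linarith [le_max_right (u x - δ k) 0]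
      · have := max_le (by linarith [hδ0 k, hnonneg x] : u x - δ k ≤ u x) (hnonneg x)
        linarith [hnonneg x]
    · have h1 : Tendsto (fun k => max (u x - δ k) 0 - u x) atTop (𝓝 (max (u x - 0) 0 - u x)) :=
        ((tendsto_const_nhds.sub hδlim).max tendsto_const_nhds).sub_const _
      simpa [max_eq_left (hnonneg x)] using h1
  have hδ' : ∀ k : ℕ, 0 < ENNReal.ofReal (δ k) := fun k => ENNReal.ofReal_pos.2 (hδ0 k)
  choose φ hφs hφc hφg hφ using fun k => exists_contDiff_hasCompactSupport_eLpNorm_lt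
    (sobolevExponent_ne_zero hN) (sobolevExponent_ne_top N) (hvl k)
    (hasCompactSupport_truncate hlim (hδ0 k)) (hδ' k)
  have hδlim' : Tendsto (fun k => ENNReal.ofReal (δ k)) atTop (𝓝 0) := by
    simpa using ENNReal.tendsto_ofReal hδlim
  have hp1 : 1 ≤ sobolevExponent N := by
    have h3 : (3 : ℝ) ≤ N := by exact_mod_cast hN
    rw [sobolevExponent, ENNReal.one_le_ofReal, le_div_iff₀ (by linarith)]
    linarith
  refine ⟨hu.continuous.aestronglyMeasurable, (measurable_gradient u).aestronglyMeasurable, φ,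
    fun k => ⟨hφs k, hφc k⟩, ?_, ?_⟩
  · refine tendsto_of_tendsto_of_tendsto_of_le_of_le tendsto_const_nhds
      (by simpa using hδlim'.add hgconv) (fun _ => zero_le) fun k => ?_
    refine le_trans ?_ (add_le_add_left (hφg k).le _)
    refine le_trans (le_of_eq ?_) (eLpNorm_add_le
      ((measurable_gradient (φ k)).sub (measurable_gradient (v k))).aestronglyMeasurable
      ((measurable_gradient (v k)).sub (measurable_gradient u)).aestronglyMeasurable
      (by norm_num))
    congr 1
    ext1 x
    simp
  · refine tendsto_of_tendsto_of_tendsto_of_le_of_le tendsto_const_nhds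
      (by simpa using hδlim'.add hconv) (fun _ => zero_le) fun k => ?_
    refine le_trans ?_ (add_le_add_left (hφ k).le _)
    refine le_trans (le_of_eq ?_) (eLpNorm_add_le
      ((hφs k).continuous.sub (hvl k).continuous).aestronglyMeasurable
      ((hvl k).continuous.sub hu.continuous).aestronglyMeasurable hp1)
    congr 1
    ext1 x
    simp

end Truncation

/-! ### Harmonicity of the fundamental solution -/

section Harmonic

theorem hasFDerivAt_norm_sq_rpow {N : ℕ} (b : ℝ) {y : RN N} (hy : y ≠ 0) :
    HasFDerivAt (fun y : RN N => (‖y‖ ^ 2) ^ b)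
      ((b * (‖y‖ ^ 2) ^ (b - 1)) • (2 • innerSL ℝ y)) y :=
  (hasStrictFDerivAt_norm_sq y).hasFDerivAt.rpow_const (Or.inl (by simpa using hy))

/-- Summed over an orthonormal basis, this yields `2 * a * (N + 2 * a - 2) * (‖y‖ ^ 2) ^ (a - 1)`,
which vanishes for `a = (2 - N) / 2`. -/
theorem fderiv_fderiv_norm_sq_rpow {N : ℕ} (a : ℝ) {y : RN N} (hy : y ≠ 0) (v : RN N) :
    fderiv ℝ (fderiv ℝ fun y : RN N => (‖y‖ ^ 2) ^ a) y v v =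
      2 * a * (‖y‖ ^ 2) ^ (a - 1) * ‖v‖ ^ 2 +
        4 * a * (a - 1) * (‖y‖ ^ 2) ^ (a - 1 - 1) * inner ℝ y v ^ 2 := by
  obtain ⟨L, hL⟩ : ∃ L : RN N →L[ℝ] RN N →L[ℝ] ℝ, ∀ v w, L v w = inner ℝ v w :=
    ⟨innerSL ℝ, fun _ _ => rfl⟩
  have h1 : fderiv ℝ (fun y : RN N => (‖y‖ ^ 2) ^ a) =ᶠ[𝓝 y]
      fun z => (2 * a * (‖z‖ ^ 2) ^ (a - 1)) • L z := by
    filter_upwards [isOpen_ne.mem_nhds hy] with z hz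
    rw [(hasFDerivAt_norm_sq_rpow a hz).fderiv]
    ext v
    simp [hL]
    ring
  have h2 : HasFDerivAt (fun z : RN N => (2 * a * (‖z‖ ^ 2) ^ (a - 1)) • L z) _ y :=
    ((hasFDerivAt_norm_sq_rpow (a - 1) hy).const_mul (2 * a)).smul
      L.hasFDerivAt
  rw [h1.fderiv_eq, h2.fderiv, ← real_inner_self_eq_norm_sq v]
  simp [hL]
  ring

/-- The fundamental solution of the Laplacian is harmonic away from the origin. -/
theorem harmonicAt_norm_sq_rpow {N : ℕ} {x : RN N} (hx : x ≠ 0) :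
    InnerProductSpace.HarmonicAt (fun y : RN N => (‖y‖ ^ 2) ^ ((2 - (N : ℝ)) / 2)) x := by
  refine ⟨((contDiff_norm_sq ℝ).contDiffAt).rpow_const_of_ne (by simpa using hx), ?_⟩
  filter_upwards [isOpen_ne.mem_nhds hx] with y hy
  have hy2 : ‖y‖ ^ 2 ≠ 0 := by simpa using hy
  have hsum : ∑ i, y i ^ 2 = ‖y‖ ^ 2 := (EuclideanSpace.real_norm_sq_eq y).symm
  rw [InnerProductSpace.laplacian_eq_iteratedFDeriv_orthonormalBasis _
    (EuclideanSpace.basisFun (Fin N) ℝ)]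
  simp only [iteratedFDeriv_two_apply, Matrix.cons_val_zero, Matrix.cons_val_one,
    fderiv_fderiv_norm_sq_rpow _ hy, EuclideanSpace.basisFun_apply, PiLp.norm_single,
    EuclideanSpace.inner_single_right, norm_one, one_pow, mul_one, one_mul, conj_trivial,
    Pi.zero_apply]
  rw [Finset.sum_add_distrib, ← Finset.mul_sum, ← Finset.mul_sum, hsum, Finset.sum_const, Finset.card_univ,
    Fintype.card_fin, nsmul_eq_mul, ← sub_add_cancel ((2 - (N : ℝ)) / 2 - 1) 1,
    Real.rpow_add_one hy2, add_sub_cancel_right]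
  ring

end Harmonic

/-! ### The extremal function and its energy -/

section Extremal

theorem norm_gradient_comp_norm {N : ℕ} {g : ℝ → ℝ} {g' : ℝ} {x : RN N} (hx : x ≠ 0)
    (hg : HasDerivAt g g' ‖x‖) : ‖gradient (fun y : RN N => g ‖y‖) x‖ = |g'| := by
  have : Nontrivial (RN N) := ⟨x, 0, hx⟩
  have hd : DifferentiableAt ℝ (fun y : RN N => ‖y‖) x :=
    (contDiffAt_norm ℝ hx (n := 1)).differentiableAt (by simp)
  have h := hg.comp_hasFDerivAt x hd.hasFDerivAt
  rw [gradient, LinearIsometryEquiv.norm_map, show fderiv ℝ (fun y : RN N => g ‖y‖) x = _ from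
    h.fderiv, norm_smul, norm_fderiv_norm hd, mul_one, Real.norm_eq_abs]

theorem barR_add_two (n : ℕ) : barR (n + 2) = (n : ℝ) / (n + 1) := by
  rw [barR]
  push_cast
  congr 1 <;> ring

theorem barR_pos {n : ℕ} (hn : 1 ≤ n) : 0 < barR (n + 2) := by
  have : (1 : ℝ) ≤ n := by exact_mod_cast hn
  rw [barR_add_two]
  positivity

theorem half_le_barR {n : ℕ} (hn : 1 ≤ n) : 1 / 2 ≤ barR (n + 2) := by
  have : (1 : ℝ) ≤ n := by exact_mod_cast hn
  rw [barR_add_two, div_le_div_iff₀ (by norm_num) (by positivity)]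
  linarith

theorem barR_lt_one (n : ℕ) : barR (n + 2) < 1 := by
  rw [barR_add_two, div_lt_one (by positivity)]
  linarith

/-- This is the matching of first derivatives: it makes the slope of the tail equal to `-1` at the
radius `barR (n + 2)`. -/
theorem mul_one_sub_barR (n : ℕ) : n * (1 - barR (n + 2)) = barR (n + 2) := by
  rw [barR_add_two]
  field_simp
  ring

/-- The radial profile of `extremal (n + 2)`. -/
noncomputable def extremalProfile (n : ℕ) (r : ℝ) : ℝ :=
  if r ≤ barR (n + 2) then 1 - r else barR (n + 2) ^ n * (1 - barR (n + 2)) / r ^ n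

theorem extremal_eq (n : ℕ) : extremal (n + 2) = fun x => extremalProfile n ‖x‖ := rfl

theorem extremal_apply (n : ℕ) (x : RN (n + 2)) : extremal (n + 2) x = extremalProfile n ‖x‖ := rfl

theorem hasDerivAt_tail {n : ℕ} (hn : 1 ≤ n) {r : ℝ} (hr : 0 < r) :
    HasDerivAt (fun s : ℝ => barR (n + 2) ^ n * (1 - barR (n + 2)) / s ^ n)
      (-(barR (n + 2) / r) ^ (n + 1)) r := by
  have h := ((hasDerivAt_pow n r).inv (pow_ne_zero n hr.ne')).const_mul
    (barR (n + 2) ^ n * (1 - barR (n + 2)))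
  obtain ⟨k, rfl⟩ : ∃ k, n = k + 1 := ⟨n - 1, by omega⟩
  have e := mul_one_sub_barR (k + 1)
  refine h.congr_deriv ?_
  generalize barR (k + 1 + 2) = R at *
  rw [div_pow, pow_succ R (k + 1), ← e]
  push_cast
  field_simp
  push_cast at e
  rw [e]
  ring

theorem hasDerivAt_extremalProfile_of_lt {n : ℕ} {r : ℝ} (hr : r < barR (n + 2)) :
    HasDerivAt (extremalProfile n) (-1) r := by
  refine ((hasDerivAt_id r).const_sub 1).congr_of_eventuallyEq ?_
  filter_upwards [Iio_mem_nhds hr] with s hs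
  simp [extremalProfile, (Set.mem_Iio.1 hs).le]

theorem hasDerivAt_extremalProfile_of_gt {n : ℕ} (hn : 1 ≤ n) {r : ℝ} (hr : barR (n + 2) < r) :
    HasDerivAt (extremalProfile n) (-(barR (n + 2) / r) ^ (n + 1)) r := by
  refine (hasDerivAt_tail hn ((barR_pos hn).trans hr)).congr_of_eventuallyEq ?_
  filter_upwards [Ioi_mem_nhds hr] with s hs
  simp [extremalProfile, not_le.2 (Set.mem_Ioi.1 hs)]

/-- Up to a constant, the profile is a difference of two `1`-Lipschitz functions, each constant on
one side of `R`. The constant `2` is not sharp, but the gradient bound `1` is proved separately. -/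
theorem lipschitzWith_extremalProfile {n : ℕ} (hn : 1 ≤ n) :
    LipschitzWith 2 (extremalProfile n) := by
  set R := barR (n + 2) with hR
  have hR0 : 0 < R := barR_pos hn
  set g : ℝ → ℝ := fun s => R ^ n * (1 - R) / s ^ n with hg
  have hgl : LipschitzOnWith 1 g (Set.Ici R) := by
    refine (convex_Ici R).lipschitzOnWith_of_nnnorm_deriv_le
      (fun r hr => (hasDerivAt_tail hn (hR0.trans_le hr)).differentiableAt) fun r hr => ?_
    have hr0 : 0 < r := hR0.trans_le hr
    rw [(hasDerivAt_tail hn hr0).deriv, ← NNReal.coe_le_coe, coe_nnnorm, norm_neg,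
      Real.norm_of_nonneg (by positivity)]
    exact pow_le_one₀ (by positivity) ((div_le_one hr0).2 hr)
  have hmax : LipschitzWith 1 fun r : ℝ => g (max r R) := by
    have := hgl.comp (g := g) (f := fun r : ℝ => max r R) (s := Set.univ)
      ((LipschitzWith.id.max_const R).lipschitzOnWith) fun r _ => le_max_right r R
    simpa [Function.comp_def, lipschitzOnWith_univ] using this
  have hmin : LipschitzWith 1 fun r : ℝ => min r R := LipschitzWith.id.min_const R
  have heq : extremalProfile n = fun r => g (max r R) - min r R + R := by
    ext r
    have hgR : g R = 1 - R := by simp only [hg]; field_simp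
    rcases le_or_gt r R with h | h
    · rw [max_eq_right h, min_eq_left h, hgR, extremalProfile, if_pos h]
      ring
    · rw [max_eq_left h.le, min_eq_right h.le, extremalProfile, if_neg (not_le.2 h)]
      ring
  rw [heq]
  exact ((hmax.sub hmin).add (LipschitzWith.const R)).weaken (by norm_num)

theorem lipschitzWith_extremal {n : ℕ} (hn : 1 ≤ n) : LipschitzWith 2 (extremal (n + 2)) := by
  simpa [extremal_eq, Function.comp_def] using
    (lipschitzWith_extremalProfile hn).comp (lipschitzWith_one_norm (E := RN (n + 2)))

theorem extremal_nonneg {n : ℕ} (hn : 1 ≤ n) (x : RN (n + 2)) : 0 ≤ extremal (n + 2) x := by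
  have h0 := barR_pos hn
  have h1 := barR_lt_one n
  rw [extremal_apply, extremalProfile]
  split_ifs with h
  · linarith
  · have : 0 ≤ 1 - barR (n + 2) := by linarith
    positivity

/-- A single majorant for both decay and integrability. The `3` comes from `‖x‖ ≥ 1 / 2` outside the
ball, whence `1 + ‖x‖ ≤ 3 * ‖x‖`. -/
theorem extremal_le {n : ℕ} (hn : 1 ≤ n) (x : RN (n + 2)) :
    extremal (n + 2) x ≤ (3 / (1 + ‖x‖)) ^ n := by
  have h0 := barR_pos hn
  have h1 := barR_lt_one n
  have h2 := half_le_barR hn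
  rw [extremal_apply, extremalProfile]
  split_ifs with h
  · refine le_trans (by linarith [norm_nonneg x]) (one_le_pow₀ (n := n) ?_)
    rw [le_div_iff₀ (by positivity)]
    linarith
  · push Not at h
    have hx : 0 < ‖x‖ := h0.trans h
    have h3 : barR (n + 2) ^ n * (1 - barR (n + 2)) ≤ 1 :=
      mul_le_one₀ (pow_le_one₀ h0.le h1.le) (by linarith) (by linarith)
    calc _ ≤ 1 / ‖x‖ ^ n := by gcongr
      _ = (1 / ‖x‖) ^ n := by rw [div_pow, one_pow]
      _ ≤ _ := by
        gcongr ?_ ^ n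
        rw [div_le_div_iff₀ hx (by positivity)]
        linarith

theorem tendsto_extremal_cocompact {n : ℕ} (hn : 1 ≤ n) :
    Tendsto (extremal (n + 2)) (cocompact _) (𝓝 0) := by
  refine tendsto_of_tendsto_of_tendsto_of_le_of_le tendsto_const_nhds ?_
    (extremal_nonneg hn) (extremal_le hn)
  have h1 : Tendsto (fun x : RN (n + 2) => 1 + ‖x‖) (cocompact _) atTop :=
    tendsto_atTop_add_const_left _ _ tendsto_norm_cocompact_atTop
  have h2 := (h1.const_div_atTop 3).pow n
  rwa [zero_pow (by omega)] at h2

theorem memLp_extremal {n : ℕ} (hn : 1 ≤ n) :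
    MemLp (extremal (n + 2)) (sobolevExponent (n + 2)) volume := by
  have hn0 : (0 : ℝ) < n := by exact_mod_cast hn
  have hp0 := sobolevExponent_ne_zero (N := n + 2) (by omega)
  have hpt := sobolevExponent_ne_top (n + 2)
  have hmeas := (lipschitzWith_extremal hn).continuous.aestronglyMeasurable
    (μ := (volume : Measure (RN (n + 2))))
  have hp : (sobolevExponent (n + 2)).toReal = 2 * (n + 2) / n := by
    rw [sobolevExponent, ENNReal.toReal_ofReal]
    · push_cast; congr 1; ring
    · push_cast; rw [show (n : ℝ) + 2 - 2 = n by ring]; positivity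
  rw [← integrable_norm_rpow_iff hmeas hp0 hpt, hp]
  -- The decay exponent `n` times the Sobolev exponent is `2 * (n + 2)`, which exceeds the
  -- dimension.
  have h_integrable : Integrable (fun x : RN (n + 2) => (1 + ‖x‖) ^ (-(2 * (n + 2) : ℝ))) :=
    integrable_one_add_norm (by rw [finrank_euclideanSpace_fin]; push_cast; linarith)
  refine (h_integrable.const_mul (3 ^ (2 * (n + 2) : ℝ))).mono'
    ((hmeas.norm.aemeasurable.pow_const _).aestronglyMeasurable)
    (Eventually.of_forall fun x => ?_)
  have hx := norm_nonneg x
  rw [Real.norm_of_nonneg (by positivity), Real.norm_of_nonneg (extremal_nonneg hn x)]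
  calc _ ≤ ((3 / (1 + ‖x‖)) ^ n) ^ (2 * (n + 2) / n : ℝ) :=
        Real.rpow_le_rpow (extremal_nonneg hn x) (extremal_le hn x) (by positivity)
    _ = (3 / (1 + ‖x‖)) ^ (2 * (n + 2) : ℝ) := by
        rw [← Real.rpow_natCast, ← Real.rpow_mul (by positivity)]
        congr 1
        field_simp
    _ = _ := by
        rw [Real.div_rpow (by norm_num) (by positivity), Real.rpow_neg (by positivity),
          div_eq_mul_inv]

/-- The modulus of the slope of `extremalProfile n`. -/
noncomputable def extremalSlope (n : ℕ) (r : ℝ) : ℝ :=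
  if r ≤ barR (n + 2) then 1 else (barR (n + 2) / r) ^ (n + 1)

theorem norm_gradient_extremal {n : ℕ} (hn : 1 ≤ n) :
    ∀ᵐ x : RN (n + 2), ‖gradient (extremal (n + 2)) x‖ = extremalSlope n ‖x‖ := by
  have h1 : ∀ᵐ x : RN (n + 2), x ∉ Metric.sphere (0 : RN (n + 2)) (barR (n + 2)) :=
    measure_eq_zero_iff_ae_notMem.1 (Measure.addHaar_sphere volume _ _)
  have h2 : ∀ᵐ x : RN (n + 2), x ∉ ({0} : Set (RN (n + 2))) :=
    measure_eq_zero_iff_ae_notMem.1 (measure_singleton _)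
  filter_upwards [h1, h2] with x hx hx0
  have hx0' : x ≠ 0 := hx0
  rw [mem_sphere_zero_iff_norm] at hx
  rw [extremal_eq, extremalSlope]
  rcases lt_or_gt_of_ne hx with h | h
  · rw [norm_gradient_comp_norm hx0' (hasDerivAt_extremalProfile_of_lt h), if_pos h.le]
    simp
  · have : 0 < barR (n + 2) := barR_pos hn
    rw [norm_gradient_comp_norm hx0' (hasDerivAt_extremalProfile_of_gt hn h),
      if_neg (not_le.2 h), abs_neg, abs_of_nonneg (by positivity)]

theorem measurable_extremalSlope (n : ℕ) : Measurable (extremalSlope n) :=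
  Measurable.ite measurableSet_Iic measurable_const (by fun_prop)

theorem extremalSlope_le_one {n : ℕ} (hn : 1 ≤ n) (r : ℝ) : extremalSlope n r ≤ 1 := by
  have h0 := barR_pos hn
  rw [extremalSlope]
  split_ifs with h
  · exact le_rfl
  · push Not at h
    exact pow_le_one₀ (div_nonneg h0.le (h0.trans h).le) ((div_le_one (h0.trans h)).2 h.le)

theorem eLpNorm_top_gradient_extremal_le {n : ℕ} (hn : 1 ≤ n) :
    eLpNorm (gradient (extremal (n + 2))) ∞ volume ≤ 1 := by
  rw [eLpNorm_exponent_top]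
  refine eLpNormEssSup_le_of_ae_enorm_bound ?_
  filter_upwards [norm_gradient_extremal hn] with x hx
  rw [← ofReal_norm, hx, ENNReal.ofReal_le_one]
  exact extremalSlope_le_one hn _

theorem lintegral_extremalSlope {n : ℕ} (hn : 1 ≤ n) :
    ∫⁻ r in Set.Ioi (0 : ℝ), ENNReal.ofReal (r ^ (n + 1)) * ENNReal.ofReal (extremalSlope n r) ^ 2 =
      ENNReal.ofReal (2 / (n + 2 : ℝ) * ((n : ℝ) / (n + 1)) ^ (n + 1)) := by
  have hn0 : (0 : ℝ) < n := by exact_mod_cast hn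
  set R := barR (n + 2) with hR
  have hR0 : 0 < R := barR_pos hn
  rw [← Set.Ioc_union_Ioi_eq_Ioi hR0.le, lintegral_union measurableSet_Ioi
    (Set.Ioc_disjoint_Ioi le_rfl)]
  have e1 : ∫⁻ r in Set.Ioc 0 R,
      ENNReal.ofReal (r ^ (n + 1)) * ENNReal.ofReal (extremalSlope n r) ^ 2 =
      ENNReal.ofReal (R ^ (n + 2) / (n + 2)) := by
    have : ∫⁻ r in Set.Ioc 0 R,
        ENNReal.ofReal (r ^ (n + 1)) * ENNReal.ofReal (extremalSlope n r) ^ 2 =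
        ∫⁻ r in Set.Ioc 0 R, ENNReal.ofReal (r ^ (n + 1)) := by
      refine setLIntegral_congr_fun measurableSet_Ioc fun r hr => ?_
      simp [extremalSlope, ← hR, hr.2]
    rw [this, ← ofReal_integral_eq_lintegral_ofReal (intervalIntegral.intervalIntegrable_pow _).1,
      ← intervalIntegral.integral_of_le hR0.le, integral_pow]
    · congr 1
      push_cast
      simp
      ring
    · filter_upwards [ae_restrict_mem measurableSet_Ioc] with r hr
      exact pow_nonneg hr.1.le _
  have e2 : ∫⁻ r in Set.Ioi R,
      ENNReal.ofReal (r ^ (n + 1)) * ENNReal.ofReal (extremalSlope n r) ^ 2 =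
      ENNReal.ofReal (R ^ (n + 2) / n) := by
    have : ∫⁻ r in Set.Ioi R,
        ENNReal.ofReal (r ^ (n + 1)) * ENNReal.ofReal (extremalSlope n r) ^ 2 =
        ∫⁻ r in Set.Ioi R, ENNReal.ofReal ((R ^ (n + 1)) ^ 2 * r ^ (-(n + 1 : ℝ))) := by
      refine setLIntegral_congr_fun measurableSet_Ioi fun r hr => ?_
      have hr' : R < r := hr
      have hr0 : 0 < r := hR0.trans hr'
      rw [extremalSlope, if_neg (not_le.2 hr'), ← ENNReal.ofReal_pow (by positivity),
        ← ENNReal.ofReal_mul (by positivity), ← hR, Real.rpow_neg hr0.le,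
        show (n + 1 : ℝ) = ((n + 1 : ℕ) : ℝ) by push_cast; rfl, Real.rpow_natCast, div_pow]
      congr 1
      field_simp
    have hlt : -(n + 1 : ℝ) < -1 := by linarith
    rw [this, ← ofReal_integral_eq_lintegral_ofReal
      ((integrableOn_Ioi_rpow_of_lt hlt hR0).const_mul _), integral_const_mul,
      integral_Ioi_rpow_of_lt hlt hR0]
    · congr 1
      rw [show -(n + 1 : ℝ) + 1 = -(n : ℝ) by ring, Real.rpow_neg hR0.le, Real.rpow_natCast]
      field_simp
      ring
    · filter_upwards [ae_restrict_mem measurableSet_Ioi] with r hr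
      have : 0 < r := hR0.trans hr
      positivity
  -- The two pieces combine through `R = n / (n + 1)`, which lowers the power of `R` by one.
  rw [e1, e2, ← ENNReal.ofReal_add (by positivity) (by positivity), ← barR_add_two, ← hR]
  congr 1
  rw [pow_succ R (n + 1)]
  generalize R ^ (n + 1) = b
  rw [hR, barR_add_two]
  field_simp
  ring

theorem eLpNorm_two_gradient_extremal {n : ℕ} (hn : 1 ≤ n) :
    eLpNorm (gradient (extremal (n + 2))) 2 volume ^ 2 =
      ENNReal.ofReal (sharpConstant (n + 2)) := by
  have h1 : ∫⁻ x, ‖gradient (extremal (n + 2)) x‖ₑ ^ 2 =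
      ∫⁻ x : RN (n + 2), ENNReal.ofReal (extremalSlope n ‖x‖) ^ 2 := by
    refine lintegral_congr_ae ?_
    filter_upwards [norm_gradient_extremal hn] with x hx
    rw [← ofReal_norm, hx]
  have h2 : ∀ θ : Metric.sphere (0 : RN (n + 2)) 1, ∫⁻ r in Set.Ioi (0 : ℝ),
      ENNReal.ofReal (r ^ (Module.finrank ℝ (RN (n + 2)) - 1)) *
        ENNReal.ofReal (extremalSlope n ‖r • (θ : RN (n + 2))‖) ^ 2 =
      ENNReal.ofReal (2 / (n + 2 : ℝ) * ((n : ℝ) / (n + 1)) ^ (n + 1)) := by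
    intro θ
    rw [← lintegral_extremalSlope hn]
    refine setLIntegral_congr_fun measurableSet_Ioi fun r hr => ?_
    simp [norm_smul, abs_of_pos (Set.mem_Ioi.1 hr)]
  rw [eLpNorm_two_pow_two, h1, lintegral_polarCoord volume
    (f := fun x : RN (n + 2) => ENNReal.ofReal (extremalSlope n ‖x‖) ^ 2)
    (((measurable_extremalSlope n).comp measurable_norm).ennreal_ofReal.pow_const 2)]
  rw [lintegral_congr h2, lintegral_const, ← ofReal_measureReal,
    ← ENNReal.ofReal_mul (by positivity), sharpConstant, sphereArea]
  congr 2
  push_cast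
  rw [show (n : ℝ) + 2 - 2 = n by ring, show (n : ℝ) + 2 - 1 = n + 1 by ring]

/-- The set where the bound holds is closed by continuity and dense because it has full measure. -/
theorem enorm_le_eLpNorm_top_of_continuous {N : ℕ} {u : RN N → ℝ} (hu : Continuous u)
    (x : RN N) : ‖u x‖ₑ ≤ eLpNorm u ∞ volume := by
  rw [eLpNorm_exponent_top]
  have hd := Measure.dense_of_ae (enorm_ae_le_eLpNormEssSup u volume)
  have hc : IsClosed {y | ‖u y‖ₑ ≤ eLpNormEssSup u volume} :=
    isClosed_le hu.enorm continuous_const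
  have := hd x
  rwa [hc.closure_eq] at this

theorem extremal_mem_spaceX {n : ℕ} (hn : 1 ≤ n) : extremal (n + 2) ∈ spaceX (n + 2) := by
  refine ⟨⟨_, hasD12Gradient_of_lipschitzWith (by omega) (lipschitzWith_extremal hn)
    (extremal_nonneg hn) (tendsto_extremal_cocompact hn) (memLp_extremal hn)
    ⟨(measurable_gradient _).aestronglyMeasurable, ?_⟩⟩, ⟨2, lipschitzWith_extremal hn⟩,
    eLpNorm_top_gradient_extremal_le hn⟩
  have h : eLpNorm (gradient (extremal (n + 2))) 2 volume ^ 2 < ⊤ := by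
    rw [eLpNorm_two_gradient_extremal hn]
    exact ENNReal.ofReal_lt_top
  exact (ENNReal.pow_lt_top_iff.1 h).resolve_right (by norm_num)

theorem extremal_zero {n : ℕ} (hn : 1 ≤ n) : extremal (n + 2) 0 = 1 := by
  simp [extremal_eq, extremalProfile, (barR_pos hn).le]

theorem energyRatio_extremal_le {n : ℕ} (hn : 1 ≤ n) :
    energyRatio (extremal (n + 2)) ≤ ENNReal.ofReal (sharpConstant (n + 2)) := by
  rw [energyRatio, eLpNorm_two_gradient_extremal hn]
  have h := enorm_le_eLpNorm_top_of_continuous (lipschitzWith_extremal hn).continuous 0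
  rw [extremal_zero hn, enorm_one] at h
  refine ENNReal.div_le_of_le_mul ?_
  exact le_mul_of_one_le_right' (one_le_pow₀ h)

theorem harmonicOnNhd_extremal {n : ℕ} (hn : 1 ≤ n) :
    InnerProductSpace.HarmonicOnNhd (extremal (n + 2)) {x | barR (n + 2) < ‖x‖} := by
  intro x hx
  have hx' : barR (n + 2) < ‖x‖ := hx
  have hx0 : x ≠ 0 := norm_pos_iff.1 ((barR_pos hn).trans hx')
  refine (InnerProductSpace.harmonicAt_congr_nhds ?_).2 ((harmonicAt_norm_sq_rpow hx0).const_smul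
    (c := barR (n + 2) ^ n * (1 - barR (n + 2))))
  filter_upwards [continuous_norm.continuousAt.eventually_const_lt hx'] with y hy
  have hy0 : 0 < ‖y‖ := (barR_pos hn).trans hy
  rw [extremal_apply, extremalProfile, if_neg (not_le.2 hy), Pi.smul_apply, smul_eq_mul,
    div_eq_mul_inv, ← Real.rpow_natCast ‖y‖ 2, ← Real.rpow_mul hy0.le,
    show (((2 : ℕ) : ℝ) * ((2 - ((n + 2 : ℕ) : ℝ)) / 2)) = -(n : ℝ) by push_cast; ring,
    Real.rpow_neg hy0.le, Real.rpow_natCast]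

end Extremal

/-! ### The best constant and its attainment -/

theorem lemma3p5 (N : ℕ) (hN : 3 ≤ N) :
    -- the value of the best constant
    bestConstant N =
      ENNReal.ofReal (2 / (N : ℝ) * (((N : ℝ) - 2) / ((N : ℝ) - 1)) ^ (N - 1) * sphereArea N) ∧
    -- it is the largest constant for which the inequality holds on the whole of `X`
    IsGreatest {C : ℝ≥0∞ | ∀ u ∈ spaceX N,
      C * eLpNorm u ∞ volume ^ N ≤ eLpNorm (gradient u) 2 volume ^ 2} (bestConstant N) ∧
    -- it is attained by the explicit radial function, harmonic outside the ball
    extremal N ∈ spaceX N \ {0} ∧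
    energyRatio (extremal N) = bestConstant N ∧
    InnerProductSpace.HarmonicOnNhd (extremal N) {x | barR N < ‖x‖} := by
  obtain ⟨n, rfl⟩ : ∃ n, N = n + 2 := ⟨N - 2, by omega⟩
  have hn : 1 ≤ n := by omega
  have hmem : extremal (n + 2) ∈ spaceX (n + 2) \ {0} :=
    ⟨extremal_mem_spaceX hn, fun h => by simpa [extremal_zero hn] using congrFun h 0⟩
  have hbest : bestConstant (n + 2) = ENNReal.ofReal (sharpConstant (n + 2)) :=
    le_antisymm ((iInf₂_le _ hmem).trans (energyRatio_extremal_le hn))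
      (le_iInf₂ fun _ hu => sharpConstant_le_energyRatio hN hu)
  have hratio : energyRatio (extremal (n + 2)) = bestConstant (n + 2) :=
    le_antisymm (hbest ▸ energyRatio_extremal_le hn) (iInf₂_le _ hmem)
  refine ⟨hbest, ⟨fun u hu => ?_, fun C hC => ?_⟩, hmem, hratio, harmonicOnNhd_extremal hn⟩
  · rw [hbest]
    exact sharpConstant_mul_eLpNorm_top_pow_le hN hu
  -- Maximality is tested on the extremal function alone; its sup norm is neither `0` nor `⊤`, so
  -- division is legitimate.
  · rw [← hratio, energyRatio, ENNReal.le_div_iff_mul_le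
      (.inl (pow_ne_zero _ (eLpNorm_top_ne_zero_of_continuous
        (lipschitzWith_extremal hn).continuous hmem.2)))
      (.inl (ENNReal.pow_ne_top (eLpNorm_top_ne_top_of_mem_spaceX hN hmem.1)))]
    exact hC _ hmem.1
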